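/- Let $\mathcal T$ be an essentially small triangulated category. A thick subcategory of $\mathcal T$ is a full triangulated subcategory closed under direct summands. Let $\operatorname{Thick}\mathcal T$ be the lattice of thick subcategories of $\mathcal T$, ordered by inclusion, so that the meet $\mathcal U\wedge\mathcal V$ is the intersection and the join of a family is the smallest thick subcategory containing all its members. Two thick subcategories $\mathcal U,\mathcal V$ are called commuting if every morphism between an object of $\mathcal U$ and an object of $\mathcal V$ (in either direction) factors through an object of $\mathcal U\wedge\mathcal V$. A thick subcategory is called central if it commutes with every thick subcategory of $\mathcal T$. Let $(\mathcal U_i)_{i\in I}$ be a family of central thick subcategories of $\mathcal T$. Then $\bigvee_{i\in I}\mathcal U_i$ is central, and \[\bigvee_{i\in I}(\mathcal U_i\wedge\mathcal V)=\Big(\bigvee_{i\in I}\mathcal U_i\Big)\wedge\mathcal V\] for all thick subcategories $\mathcal V$ of $\mathcal T$. -/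

import Mathlib

open CategoryTheory Limits Pretriangulated

universe u v w w'

section

variable (C : Type u) [Category.{v} C] [HasZeroObject C] [HasShift C ℤ] [Preadditive C]
  [∀ n : ℤ, (shiftFunctor C n).Additive] [Pretriangulated C]

/-- A thick subcategory of a triangulated category, given by its class of objects: a full
triangulated subcategory (contains zero, closed under all shifts and under extensions in
distinguished triangles) that is closed under retracts (direct summands), in particular under
isomorphisms. -/
@[ext]
structure ThickSubcategory where
  /-- The class of objects of the thick subcategory. -/
  obj : ObjectProperty C
  isTriangulated : obj.IsTriangulated
  isStableUnderRetracts : obj.IsStableUnderRetracts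

namespace ThickSubcategory

variable {C}

instance (U : ThickSubcategory C) : U.obj.IsTriangulated := U.isTriangulated

instance (U : ThickSubcategory C) : U.obj.IsStableUnderRetracts := U.isStableUnderRetracts

/-- Thick subcategories are ordered by inclusion. -/
instance : PartialOrder (ThickSubcategory C) :=
  PartialOrder.lift ThickSubcategory.obj (fun _ _ h => ThickSubcategory.ext h)

lemma le_iff (U V : ThickSubcategory C) : U ≤ V ↔ ∀ X : C, U.obj X → V.obj X := Iff.rfl

/-- The intersection of a class of thick subcategories. -/
instance : InfSet (ThickSubcategory C) where
  sInf S :=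
    { obj := fun X => ∀ U ∈ S, U.obj X
      isTriangulated :=
        { exists_zero := by
            obtain ⟨Z, hZ⟩ := HasZeroObject.zero (C := C)
            exact ⟨Z, hZ, fun U _ => U.obj.prop_of_isZero hZ⟩
          isStableUnderShiftBy := fun n => ⟨fun _ hX U hU => U.obj.le_shift n _ (hX U hU)⟩
          ext₂' := fun T hT h₁ h₃ => ObjectProperty.le_isoClosure _ _ (fun U hU =>
            U.obj.ext_of_isTriangulatedClosed₂ T hT (h₁ U hU) (h₃ U hU)) }
      isStableUnderRetracts :=
        ⟨fun r hY U hU => ObjectProperty.prop_of_retract U.obj r (hY U hU)⟩ }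

/-- The lattice of thick subcategories: the meet is the intersection, and the join of a family is
the smallest thick subcategory containing all its members. -/
instance : CompleteLattice (ThickSubcategory C) :=
  completeLatticeOfInf _ (fun _ =>
    ⟨fun _ hU _ hX => hX _ hU, fun _ hV X hX _ hU => hV hU X hX⟩)

lemma inf_obj_iff (U V : ThickSubcategory C) (X : C) :
    (U ⊓ V).obj X ↔ U.obj X ∧ V.obj X := by
  refine ⟨fun h => ⟨inf_le_left (a := U) (b := V) X h, inf_le_right (a := U) (b := V) X h⟩, ?_⟩
  rintro ⟨h₁, h₂⟩ W hW
  simp only [Set.mem_insert_iff, Set.mem_singleton_iff] at hW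
  obtain rfl | rfl := hW
  exacts [h₁, h₂]

/-- Two thick subcategories are commuting if every morphism between an object of the one and an object
of the other, in either direction, factors through an object of their intersection. -/
def Commuting (U V : ThickSubcategory C) : Prop :=
  ∀ ⦃X Y : C⦄, U.obj X → V.obj Y →
    (∀ f : X ⟶ Y, ∃ (Z : C) (a : X ⟶ Z) (b : Z ⟶ Y), (U ⊓ V).obj Z ∧ a ≫ b = f) ∧
    (∀ g : Y ⟶ X, ∃ (Z : C) (a : Y ⟶ Z) (b : Z ⟶ X), (U ⊓ V).obj Z ∧ a ≫ b = g)

/-- A thick subcategory is central if it commutes with every thick subcategory. -/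
def IsCentral (U : ThickSubcategory C) : Prop :=
  ∀ V : ThickSubcategory C, Commuting U V

end ThickSubcategory

end

/-! Put `W = ⨆ i, (U i ⊓ V)`, so `W ≤ V`. The objects whose maps to `V` all factor through `W` form
a thick subcategory; closure under extensions is the real work and uses `W ≤ V`. It contains every
`U i` by commutation, hence their join. An object of the join that lies in `V` then has its identity
factoring through `W`, so it is a retract of an object of `W`. This gives distributivity; with the
dual argument for maps from `V`, commutation follows. -/

section

variable {C : Type u} [Category.{v} C] [HasZeroObject C] [HasShift C ℤ] [Preadditive C]
  [∀ n : ℤ, (shiftFunctor C n).Additive] [Pretriangulated C]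

namespace ThickSubcategory

/-- A morphism factors through an object of the thick subcategory `W`. -/
def FactorsThrough (W : ThickSubcategory C) {X Y : C} (f : X ⟶ Y) : Prop :=
  ∃ (Z : C) (a : X ⟶ Z) (b : Z ⟶ Y), W.obj Z ∧ a ≫ b = f

namespace FactorsThrough

variable {W : ThickSubcategory C}

lemma mono {W' : ThickSubcategory C} (h : W ≤ W') {X Y : C} {f : X ⟶ Y}
    (hf : W.FactorsThrough f) : W'.FactorsThrough f := by
  obtain ⟨Z, a, b, hZ, rfl⟩ := hf
  exact ⟨Z, a, b, h Z hZ, rfl⟩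

lemma comp_left {X Y Z : C} (f : X ⟶ Y) {g : Y ⟶ Z} (hg : W.FactorsThrough g) :
    W.FactorsThrough (f ≫ g) := by
  obtain ⟨E, a, b, hE, rfl⟩ := hg
  exact ⟨E, f ≫ a, b, hE, by simp⟩

lemma comp_right {X Y Z : C} {f : X ⟶ Y} (hf : W.FactorsThrough f) (g : Y ⟶ Z) :
    W.FactorsThrough (f ≫ g) := by
  obtain ⟨E, a, b, hE, rfl⟩ := hf
  exact ⟨E, a, b ≫ g, hE, by simp⟩

lemma shift {X Y : C} {f : X ⟶ Y} (hf : W.FactorsThrough f) (n : ℤ) :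
    W.FactorsThrough (f⟦n⟧') := by
  obtain ⟨E, a, b, hE, rfl⟩ := hf
  exact ⟨E⟦n⟧, a⟦n⟧', b⟦n⟧', W.obj.le_shift n _ hE, by simp⟩

lemma add {X Y : C} {f g : X ⟶ Y} (hf : W.FactorsThrough f) (hg : W.FactorsThrough g) :
    W.FactorsThrough (f + g) := by
  obtain ⟨E, a, b, hE, rfl⟩ := hf
  obtain ⟨F, c, d, hF, rfl⟩ := hg
  exact ⟨E ⊞ F, biprod.lift a c, biprod.desc b d,
    W.obj.ext_of_isTriangulatedClosed₂ _ (binaryBiproductTriangle_distinguished E F) hE hF,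
    by simp⟩

lemma of_isZero_left {X Y : C} (hX : IsZero X) (f : X ⟶ Y) : W.FactorsThrough f :=
  ⟨X, 𝟙 X, f, W.obj.prop_of_isZero hX, by simp⟩

lemma of_isZero_right {X Y : C} (hY : IsZero Y) (f : X ⟶ Y) : W.FactorsThrough f :=
  ⟨Y, f, 𝟙 Y, W.obj.prop_of_isZero hY, by simp⟩

lemma prop_of_id {X : C} (h : W.FactorsThrough (𝟙 X)) : W.obj X := by
  obtain ⟨Z, a, b, hZ, hab⟩ := h
  exact W.obj.prop_of_retract ⟨a, b, hab⟩ hZ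

end FactorsThrough

variable (W V : ThickSubcategory C)

/-- The objects all of whose morphisms to objects of `V` factor through `W`. -/
def leftFactoring : ObjectProperty C :=
  fun X => ∀ ⦃Y : C⦄, V.obj Y → ∀ f : X ⟶ Y, W.FactorsThrough f

/-- The objects all of whose morphisms from objects of `V` factor through `W`. -/
def rightFactoring : ObjectProperty C :=
  fun X => ∀ ⦃Y : C⦄, V.obj Y → ∀ f : Y ⟶ X, W.FactorsThrough f

variable {W V}

lemma leftFactoring_shift {X : C} (hX : leftFactoring W V X) (n : ℤ) :
    leftFactoring W V (X⟦n⟧) := by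
  intro Y hY f
  let adj := (shiftEquiv C n).toAdjunction
  obtain ⟨f', rfl⟩ := (adj.homEquiv X Y).symm.surjective f
  rw [Adjunction.homEquiv_counit]
  exact ((hX (V.obj.le_shift (-n) _ hY) f').shift n).comp_right _

lemma rightFactoring_shift {X : C} (hX : rightFactoring W V X) (n : ℤ) :
    rightFactoring W V (X⟦n⟧) := by
  intro Y hY f
  let adj := (shiftEquiv C n).symm.toAdjunction
  obtain ⟨f', rfl⟩ := (adj.homEquiv Y X).surjective f
  rw [Adjunction.homEquiv_unit]
  exact ((hX (V.obj.le_shift (-n) _ hY) f').shift n).comp_left _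

/-- Modulo a map from an object of `W`, `f` comes from `T.obj₃`. The factorization there lifts to an
extension of objects of `W`, and the error term again factors through `W`. -/
lemma leftFactoring_ext₂ (hWV : W ≤ V) (T : Triangle C) (hT : T ∈ distTriang C)
    (h₁ : leftFactoring W V T.obj₁) (h₃ : leftFactoring W V T.obj₃) :
    leftFactoring W V T.obj₂ := by
  intro Y hY f
  obtain ⟨A, a, b, hA, hab⟩ := h₁ hY (T.mor₁ ≫ f)
  obtain ⟨Y', p, q, hY'⟩ := distinguished_cocone_triangle b
  -- This is where `W ≤ V` enters: the hypothesis on `T.obj₃` applies only to targets in `V`.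
  have hVY' : V.obj Y' := V.obj.ext_of_isTriangulatedClosed₃ _ hY' (hWV A hA) hY
  have hbp : b ≫ p = 0 := comp_distTriang_mor_zero₁₂ _ hY'
  have hpq : p ≫ q = 0 := comp_distTriang_mor_zero₂₃ _ hY'
  obtain ⟨g, hg⟩ : ∃ g : T.obj₃ ⟶ Y', f ≫ p = T.mor₂ ≫ g :=
    Triangle.yoneda_exact₂ T hT (f ≫ p) (by
      rw [← Category.assoc, ← hab, Category.assoc, hbp, comp_zero])
  obtain ⟨Z, c, d, hZ, rfl⟩ := h₃ hVY' g
  -- `E` acts as a homotopy pullback of `d` and `p`.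
  obtain ⟨E, i, j, hE⟩ := distinguished_cocone_triangle₂ (d ≫ q)
  have hWE : W.obj E := W.obj.ext_of_isTriangulatedClosed₂ _ hE hA hZ
  obtain ⟨k, -, hk⟩ : ∃ k : E ⟶ Y, i ≫ k = 𝟙 A ≫ b ∧ j ≫ d = k ≫ p :=
    complete_distinguished_triangle_morphism₂ _ _ hE hY' (𝟙 A) d (by
      change (d ≫ q) ≫ (𝟙 A)⟦(1 : ℤ)⟧' = d ≫ q
      rw [CategoryTheory.Functor.map_id, Category.comp_id])
  obtain ⟨l, hl⟩ : ∃ l : T.obj₂ ⟶ E, T.mor₂ ≫ c = l ≫ j :=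
    Triangle.coyoneda_exact₃ _ hE (T.mor₂ ≫ c) (by
      change (T.mor₂ ≫ c) ≫ d ≫ q = 0
      have : f ≫ p ≫ q = 0 := by rw [hpq, comp_zero]
      rw [← Category.assoc, hg] at this
      simpa using this)
  -- `l ≫ k` agrees with `f` after `p`, so the difference factors through `b`.
  obtain ⟨m, hm⟩ : ∃ m : T.obj₂ ⟶ A, f - l ≫ k = m ≫ b :=
    Triangle.coyoneda_exact₂ _ hY' (f - l ≫ k) (by
      change (f - l ≫ k) ≫ p = 0
      rw [Preadditive.sub_comp, Category.assoc, ← hk, ← Category.assoc, ← hl, hg]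
      simp)
  have : f = m ≫ b + l ≫ k := by rw [← hm]; simp
  rw [this]
  exact .add ⟨A, m, b, hA, rfl⟩ ⟨E, l, k, hWE, rfl⟩

/-- Dual argument: fibres replace cones, and `E` is a homotopy pushout of `p` and `c`. -/
lemma rightFactoring_ext₂ (hWV : W ≤ V) (T : Triangle C) (hT : T ∈ distTriang C)
    (h₁ : rightFactoring W V T.obj₁) (h₃ : rightFactoring W V T.obj₃) :
    rightFactoring W V T.obj₂ := by
  intro Y hY f
  obtain ⟨B, a', b', hB, hab'⟩ := h₃ hY (f ≫ T.mor₂)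
  -- The middle object is rewritten as a shift so that `a` can be the third map of a triangle.
  obtain ⟨A, hA, a, b, hab⟩ : ∃ (A : C) (_ : W.obj A) (a : Y ⟶ A⟦(1 : ℤ)⟧)
      (b : A⟦(1 : ℤ)⟧ ⟶ T.obj₃), a ≫ b = f ≫ T.mor₂ :=
    ⟨B⟦(-1 : ℤ)⟧, W.obj.le_shift (-1) _ hB, a' ≫ (shiftNegShift B (1 : ℤ)).inv,
      (shiftNegShift B (1 : ℤ)).hom ≫ b', by
        rw [Category.assoc, Iso.inv_hom_id_assoc, hab']⟩
  obtain ⟨Y', q, p, hY'⟩ := distinguished_cocone_triangle₂ a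
  have hVY' : V.obj Y' := V.obj.ext_of_isTriangulatedClosed₂ _ hY' (hWV A hA) hY
  have hqp : q ≫ p = 0 := comp_distTriang_mor_zero₁₂ _ hY'
  have hpa : p ≫ a = 0 := comp_distTriang_mor_zero₂₃ _ hY'
  obtain ⟨g, hg⟩ : ∃ g : Y' ⟶ T.obj₁, p ≫ f = g ≫ T.mor₁ :=
    Triangle.coyoneda_exact₂ T hT (p ≫ f) (by
      rw [Category.assoc, ← hab, ← Category.assoc, hpa, zero_comp])
  obtain ⟨Z, c, d, hZ, rfl⟩ := h₁ hVY' g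
  obtain ⟨E, i, j, hE⟩ := distinguished_cocone_triangle (q ≫ c)
  have hWE : W.obj E := W.obj.ext_of_isTriangulatedClosed₃ _ hE hA hZ
  obtain ⟨k, hk, -⟩ : ∃ k : Y ⟶ E, p ≫ k = c ≫ i ∧ a ≫ (𝟙 A)⟦(1 : ℤ)⟧' = k ≫ j :=
    complete_distinguished_triangle_morphism _ _ hY' hE (𝟙 A) c (Category.id_comp (q ≫ c)).symm
  obtain ⟨l, hl⟩ : ∃ l : E ⟶ T.obj₂, d ≫ T.mor₁ = i ≫ l :=
    Triangle.yoneda_exact₂ _ hE (d ≫ T.mor₁) (by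
      change (q ≫ c) ≫ d ≫ T.mor₁ = 0
      have : (q ≫ p) ≫ f = 0 := by rw [hqp, zero_comp]
      rw [Category.assoc, hg] at this
      simpa using this)
  obtain ⟨m, hm⟩ : ∃ m : A⟦(1 : ℤ)⟧ ⟶ T.obj₂, f - k ≫ l = a ≫ m :=
    Triangle.yoneda_exact₃ _ hY' (f - k ≫ l) (by
      change p ≫ (f - k ≫ l) = 0
      rw [Preadditive.comp_sub, ← Category.assoc p k, hk, Category.assoc, ← hl, hg]
      simp)
  have : f = a ≫ m + k ≫ l := by rw [← hm]; simp
  rw [this]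
  exact .add ⟨_, a, m, W.obj.le_shift 1 _ hA, rfl⟩ ⟨E, k, l, hWE, rfl⟩

/-- If `W ≤ V`, the objects all of whose morphisms to `V` factor through `W` form a thick
subcategory. -/
def leftFactoringThick (hWV : W ≤ V) : ThickSubcategory C where
  obj := leftFactoring W V
  isTriangulated :=
    { exists_zero := by
        obtain ⟨Z, hZ⟩ := HasZeroObject.zero (C := C)
        exact ⟨Z, hZ, fun _ _ f => .of_isZero_left hZ f⟩
      isStableUnderShiftBy := fun n => ⟨fun _ hX => leftFactoring_shift hX n⟩
      ext₂' := fun T hT h₁ h₃ =>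
        ObjectProperty.le_isoClosure _ _ (leftFactoring_ext₂ hWV T hT h₁ h₃) }
  isStableUnderRetracts :=
    ⟨fun r hX _ hY f => by simpa using (hX hY (r.r ≫ f)).comp_left r.i⟩

/-- If `W ≤ V`, the objects all of whose morphisms from `V` factor through `W` form a thick
subcategory. -/
def rightFactoringThick (hWV : W ≤ V) : ThickSubcategory C where
  obj := rightFactoring W V
  isTriangulated :=
    { exists_zero := by
        obtain ⟨Z, hZ⟩ := HasZeroObject.zero (C := C)
        exact ⟨Z, hZ, fun _ _ f => .of_isZero_right hZ f⟩
      isStableUnderShiftBy := fun n => ⟨fun _ hX => rightFactoring_shift hX n⟩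
      ext₂' := fun T hT h₁ h₃ =>
        ObjectProperty.le_isoClosure _ _ (rightFactoring_ext₂ hWV T hT h₁ h₃) }
  isStableUnderRetracts :=
    ⟨fun r hX _ hY f => by simpa using (hX hY (f ≫ r.i)).comp_right r.r⟩

section

variable {I : Type w'} {U : I → ThickSubcategory C}

lemma iSup_inf_le_right (U : I → ThickSubcategory C) (V : ThickSubcategory C) :
    ⨆ i, (U i ⊓ V) ≤ V :=
  iSup_le fun _ => inf_le_right

lemma iSup_le_leftFactoringThick (hU : ∀ i, Commuting (U i) V) :
    ⨆ i, U i ≤ leftFactoringThick (iSup_inf_le_right U V) :=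
  iSup_le fun i _ hX _ hY f =>
    FactorsThrough.mono (le_iSup (fun i => U i ⊓ V) i) ((hU i hX hY).1 f)

lemma iSup_le_rightFactoringThick (hU : ∀ i, Commuting (U i) V) :
    ⨆ i, U i ≤ rightFactoringThick (iSup_inf_le_right U V) :=
  iSup_le fun i _ hX _ hY f =>
    FactorsThrough.mono (le_iSup (fun i => U i ⊓ V) i) ((hU i hX hY).2 f)

/-- For the nontrivial inclusion, the factoring property is applied to `𝟙 X`. -/
lemma iSup_inf_eq_of_commuting (hU : ∀ i, Commuting (U i) V) :
    ⨆ i, (U i ⊓ V) = (⨆ i, U i) ⊓ V := by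
  refine le_antisymm (le_inf (iSup_mono fun _ => inf_le_left) (iSup_inf_le_right U V)) fun X hX => ?_
  rw [inf_obj_iff] at hX
  exact (iSup_le_leftFactoringThick hU X hX.1 hX.2 (𝟙 X)).prop_of_id

lemma commuting_iSup (hU : ∀ i, Commuting (U i) V) : Commuting (⨆ i, U i) V := by
  intro X Y hX hY
  rw [← iSup_inf_eq_of_commuting hU]
  exact ⟨iSup_le_leftFactoringThick hU X hX hY, iSup_le_rightFactoringThick hU X hX hY⟩

end

end ThickSubcategory

end

theorem mainTheorem4 {T : Type u} [Category.{v} T] [HasZeroObject T] [HasShift T ℤ]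
    [Preadditive T] [∀ n : ℤ, (shiftFunctor T n).Additive] [Pretriangulated T]
    [IsTriangulated T] [EssentiallySmall.{w} T]
    {I : Type w'} (U : I → ThickSubcategory T) (hU : ∀ i, (U i).IsCentral) :
    (⨆ i, U i).IsCentral ∧
      ∀ V : ThickSubcategory T, (⨆ i, (U i ⊓ V)) = (⨆ i, U i) ⊓ V :=
  ⟨fun V => ThickSubcategory.commuting_iSup fun i => hU i V,
    fun V => ThickSubcategory.iSup_inf_eq_of_commuting fun i => hU i V⟩
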